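/- For a metric space $X$, $x\in X$, $\rho>0$ and $E\subset X$, let $B(x,\rho)$ be the closed ball of $X$ with centre $x$ and radius $\rho$, and let $N_\rho(E)$ be the least number of closed balls of $X$ of radius $\rho$ that cover $E$. For $0<\theta<1$ the lower spectrum of a non-empty metric space $X$ is $$\dim_{\mathrm L}^{\theta}X=\sup\Bigl\{s\ge 0:\ \exists\, C>0\ \forall\, 0<r<1,\ \ \inf_{x\in X}N_r\bigl(B(x,r^{\theta})\bigr)\ge C\Bigl(\frac{r^{\theta}}{r}\Bigr)^{s}\Bigr\}\in[0,\infty],$$ and at $\theta=1$ the expression $(1-\theta)\dim_{\mathrm L}^{\theta}X$ is understood to be $0$. A subset of $\mathbb{R}^d$ is regarded as a metric space with the Euclidean distance. For $\alpha\ge 0$ let $\mathcal H(\alpha)$ be the class of functions $\varphi:(0,1]\to[0,\alpha]$ such that for all $\lambda,\theta\in(0,1]$ both $\varphi(\lambda\theta)\ge\varphi(\theta)+\theta\varphi(\lambda)$ and $\varphi(\lambda\theta)\le(1-\theta)\alpha+\theta\varphi(\lambda)$. **Theorem.** Let $d\in\mathbb N$ and let $\varphi:(0,1]\to[0,d]$.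 Then there exists a non-empty set $F\subset\mathbb{R}^d$ such that $(1-\theta)\dim_{\mathrm L}^{\theta}F=\varphi(\theta)$ for all $\theta\in(0,1]$ if and only if $$\varphi(\theta)\le\varphi(\lambda\theta)-\theta\varphi(\lambda)\le(1-\theta)d\qquad\text{for all }\lambda,\theta\in(0,1].$$ Equivalently, the set of functions $\theta\mapsto(1-\theta)\dim_{\mathrm L}^{\theta}F$ on $(0,1]$, as $F$ ranges over the non-empty subsets of $\mathbb{R}^d$, is exactly $\mathcal H(d)$. -/

import Mathlib

open scoped NNReal ENNReal

noncomputable section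

/-- The lower spectrum of a metric space `X` at `θ`: the supremum of all `s ≥ 0` for which there is
`C > 0` such that, for every `0 < r < 1`, every closed ball `B(x, r ^ θ)` of `X` needs at least
`C (r ^ θ / r) ^ s` closed balls of radius `r` of `X` to be covered. The value is an extended
nonnegative real. `Metric.externalCoveringNumber r E` is the least number of closed balls of
radius `r`, centred anywhere in the ambient space `X`, that cover `E`. -/
def lowerSpectrum (X : Type*) [MetricSpace X] (θ : ℝ) : ℝ≥0∞ :=
  ⨆ (s : ℝ≥0) (_ : ∃ C : ℝ≥0, 0 < C ∧ ∀ r : ℝ≥0, 0 < r → r < 1 →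
      ((C * (r ^ θ / r) ^ (s : ℝ) : ℝ≥0) : ℝ≥0∞) ≤
        ⨅ x : X, ((Metric.externalCoveringNumber r
          (Metric.closedBall x ((r ^ θ : ℝ≥0) : ℝ)) : ℕ∞) : ℝ≥0∞)), (s : ℝ≥0∞)

/-- The normalized lower spectrum `θ ↦ (1 - θ) dim_L^θ X` on `(0, 1]`. The lower spectrum is only
considered for `θ < 1`; at `θ = 1` the normalized lower spectrum is `0` by convention. -/
def normalizedLowerSpectrum (X : Type*) [MetricSpace X] (θ : Set.Ioc (0 : ℝ) 1) : ℝ≥0∞ :=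
  if (θ : ℝ) = 1 then 0 else ENNReal.ofReal (1 - θ) * lowerSpectrum X θ

/-- The class `𝓗(α)` of functions `φ : (0, 1] → [0, α]` which are superadditive and weakly
Lipschitz. The product `l * θ` is the product of real numbers in `(0, 1]`. -/
def classH (α : ℝ) : Set (Set.Ioc (0 : ℝ) 1 → Set.Icc (0 : ℝ) α) :=
  {φ | (∀ l θ : Set.Ioc (0 : ℝ) 1, (φ (l * θ) : ℝ) ≥ φ θ + (θ : ℝ) * φ l) ∧
    (∀ l θ : Set.Ioc (0 : ℝ) 1, (φ (l * θ) : ℝ) ≤ (1 - (θ : ℝ)) * α + (θ : ℝ) * φ l)}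

end

/-! Put t = (1-θ)s: the normalized spectrum at θ is the supremum of the t for which every r^θ-ball
needs at least C r^{-t} balls of radius r (`Admissible`). Necessity compares three scales r ≤ s =
r^θ ≤ s^λ = r^{λθ}. Packing separated s-balls into an s^λ-ball multiplies lower bounds and gives
superadditivity (`Admissible.add_mul`). Refining an s-cover to an r-cover costs at most a constant
times (s/r)^d and gives the weak Lipschitz bound (`Admissible.of_mul`). For sufficiency, set G(u,v)
= v f(u/v), where u and v are exponents of dyadic scales. The two inequalities become G(u,v) +
G(v,w) ≤ G(u,w) and G(u,w) ≤ G(u,v) + d(w-v). Block k of the set is a product of binary digit sets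
having about G(k+1,n)/d free digits up to level n in each coordinate; the second inequality makes
one bit per level sufficient. At the corner of block k the covering number between levels k+1 and n
is about 2^{G(k+1,n)}, which bounds the spectrum above by f. Between levels j and n with j ≥ k+1 it
is, up to a constant, at least 2^{G(j,n)} by the first inequality, which bounds the spectrum below
by f. At coarser levels a full-dimensional cube attached to each block supplies enough points. -/

/-! ### Admissible exponents -/

/-- Every point of `E` is within distance `r` of a point of the finite set `T`. -/
def IsBallCover {X : Type*} [MetricSpace X] (T : Finset X) (E : Set X) (r : ℝ) : Prop :=
  ∀ x ∈ E, ∃ y ∈ T, dist x y ≤ r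

/-- Every closed ball of radius `r ^ θ` needs at least `C r ^ (-t)` balls of radius `r`. -/
def Admissible (X : Type*) [MetricSpace X] (θ t : ℝ) : Prop :=
  ∃ C : ℝ, 0 < C ∧ ∀ r : ℝ, 0 < r → r < 1 → ∀ (x : X) (T : Finset X),
    IsBallCover T (Metric.closedBall x (r ^ θ)) r → C * r ^ (-t) ≤ T.card

/-- Infinite covers have cardinality `⊤` and impose no condition; integrality of the covering number
allows passing to `⌈a⌉₊`. -/
theorem le_externalCoveringNumber_iff {X : Type*} [MetricSpace X] (a r : ℝ≥0) (E : Set X) :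
    (a : ℝ≥0∞) ≤ ((Metric.externalCoveringNumber r E : ℕ∞) : ℝ≥0∞) ↔
      ∀ T : Finset X, IsBallCover T E r → (a : ℝ) ≤ T.card := by
  have key : ∀ T : Set X, Metric.IsCover r E T ↔ ∀ x ∈ E, ∃ y ∈ T, dist x y ≤ r := by
    intro T
    rw [Metric.isCover_iff_subset_iUnion_closedBall]
    simp [Set.subset_def, Metric.mem_closedBall]
  constructor
  · intro h T hT
    have h1 : Metric.externalCoveringNumber r E ≤ (T : Set X).encard :=
      Metric.IsCover.externalCoveringNumber_le_encard ((key _).2 (by simpa [IsBallCover] using hT))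
    rw [Set.encard_coe_eq_coe_finsetCard] at h1
    have h2 : (a : ℝ≥0∞) ≤ (((T.card : ℕ) : ℕ∞) : ℝ≥0∞) :=
      h.trans (ENat.toENNReal_le.2 h1)
    have h3 : (a : ℝ≥0∞) ≤ ((T.card : ℝ≥0) : ℝ≥0∞) := by simpa using h2
    exact_mod_cast h3
  · intro h
    have h1 : ((⌈a⌉₊ : ℕ) : ℕ∞) ≤ Metric.externalCoveringNumber r E := by
      refine le_iInf₂ fun C hC => ?_
      by_cases hf : C.Finite
      · lift C to Finset X using hf
        have h2 := h C (by simpa [IsBallCover] using (key _).1 hC)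
        rw [Set.encard_coe_eq_coe_finsetCard]
        have : ⌈a⌉₊ ≤ C.card := Nat.ceil_le.2 (by exact_mod_cast h2)
        exact_mod_cast this
      · rw [Set.Infinite.encard_eq hf]; exact le_top
    have h2 : (((⌈a⌉₊ : ℕ) : ℕ∞) : ℝ≥0∞) ≤ _ := ENat.toENNReal_le.2 h1
    refine le_trans ?_ h2
    have : (a : ℝ≥0∞) ≤ (((⌈a⌉₊ : ℕ) : ℝ≥0) : ℝ≥0∞) := by exact_mod_cast Nat.le_ceil a
    simpa using this

theorem lowerSpectrum_condition_iff (X : Type*) [MetricSpace X] (θ : ℝ) (s : ℝ≥0) :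
    (∃ C : ℝ≥0, 0 < C ∧ ∀ r : ℝ≥0, 0 < r → r < 1 →
      ((C * (r ^ θ / r) ^ (s : ℝ) : ℝ≥0) : ℝ≥0∞) ≤
        ⨅ x : X, ((Metric.externalCoveringNumber r
          (Metric.closedBall x ((r ^ θ : ℝ≥0) : ℝ)) : ℕ∞) : ℝ≥0∞)) ↔
    Admissible X θ ((1 - θ) * s) := by
  have hpow : ∀ r : ℝ≥0, 0 < r → (((r ^ θ / r) ^ (s : ℝ) : ℝ≥0) : ℝ) =
      (r : ℝ) ^ (-((1 - θ) * (s : ℝ))) := by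
    intro r hr
    have hr' : (0 : ℝ) < r := hr
    push_cast
    rw [← Real.rpow_sub_one hr'.ne', ← Real.rpow_mul hr'.le]
    congr 1; ring
  simp only [le_iInf_iff, le_externalCoveringNumber_iff]
  constructor
  · rintro ⟨C, hC, h⟩
    refine ⟨C, hC, fun r hr hr1 x T hT => ?_⟩
    lift r to ℝ≥0 using hr.le
    have := h r hr (by exact_mod_cast hr1) x T (by simpa using hT)
    rwa [NNReal.coe_mul, hpow r hr] at this
  · rintro ⟨C, hC, h⟩
    lift C to ℝ≥0 using hC.le
    refine ⟨C, hC, fun r hr hr1 x T hT => ?_⟩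
    rw [NNReal.coe_mul, hpow r hr]
    exact h r hr (by exact_mod_cast hr1) x T (by simpa using hT)

theorem one_le_card_of_isBallCover {X : Type*} [MetricSpace X] {T : Finset X} {x : X} {ρ r : ℝ}
    (hρ : 0 ≤ ρ) (hT : IsBallCover T (Metric.closedBall x ρ) r) : (1 : ℝ) ≤ T.card := by
  obtain ⟨y, hy, -⟩ := hT x (Metric.mem_closedBall_self hρ)
  exact_mod_cast Finset.card_pos.2 ⟨y, hy⟩

theorem admissible_zero (X : Type*) [MetricSpace X] (θ : ℝ) : Admissible X θ 0 :=
  ⟨1, one_pos, fun r hr _ x T hT => by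
    simpa using one_le_card_of_isBallCover (Real.rpow_nonneg hr.le θ) hT⟩

/-- An exponential sequence bounded from above has nonpositive exponent. -/
theorem nonpos_of_forall_rpow_le {C K e : ℝ} (hC : 0 < C)
    (h : ∀ k : ℕ, C * (2 : ℝ) ^ ((k : ℝ) * e) ≤ K) : e ≤ 0 := by
  by_contra! he
  have h1 : (1 : ℝ) < 2 ^ e := Real.one_lt_rpow one_lt_two he
  obtain ⟨k, hk⟩ := pow_unbounded_of_one_lt (K / C) h1
  have := h k
  rw [mul_comm (k : ℝ), Real.rpow_mul two_pos.le, Real.rpow_natCast] at this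
  rw [div_lt_iff₀ hC] at hk
  linarith

/-- Admissibility only needs to be checked at small scales. -/
theorem admissible_of_small {X : Type*} [MetricSpace X] {θ t r₀ C : ℝ} (ht : 0 ≤ t) (hr₀ : 0 < r₀)
    (hC : 0 < C) (h : ∀ r : ℝ, 0 < r → r < 1 → r ≤ r₀ → ∀ (x : X) (T : Finset X),
      IsBallCover T (Metric.closedBall x (r ^ θ)) r → C * r ^ (-t) ≤ T.card) :
    Admissible X θ t := by
  -- For r ≥ r₀ one ball is always needed, and r₀^t r^{-t} ≤ 1.
  refine ⟨min C (r₀ ^ t), by positivity, fun r hr hr1 x T hT => ?_⟩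
  rcases le_total r r₀ with hle | hle
  · exact (mul_le_mul_of_nonneg_right (min_le_left _ _) (by positivity)).trans
      (h r hr hr1 hle x T hT)
  · refine le_trans ?_ (one_le_card_of_isBallCover (Real.rpow_nonneg hr.le θ) hT)
    calc min C (r₀ ^ t) * r ^ (-t) ≤ r₀ ^ t * r ^ (-t) :=
          mul_le_mul_of_nonneg_right (min_le_right _ _) (by positivity)
      _ ≤ r ^ t * r ^ (-t) := by gcongr
      _ = 1 := by rw [← Real.rpow_add hr]; simp

/-- An r-ball is covered by itself, so r^{-t} stays bounded as r → 0. This is why the convention at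
θ = 1 agrees with the supremum of admissible exponents. -/
theorem admissible_one_nonpos {X : Type*} [MetricSpace X] [Nonempty X] {t : ℝ}
    (h : Admissible X 1 t) : t ≤ 0 := by
  obtain ⟨C, hC, h⟩ := h
  obtain ⟨x⟩ := ‹Nonempty X›
  refine nonpos_of_forall_rpow_le (C := C * 2 ^ t) (K := 1) (by positivity) fun k => ?_
  have hr1 : ((1 : ℝ) / 2) ^ (k + 1) < 1 := pow_lt_one₀ (by norm_num) (by norm_num) (by simp)
  have := h ((1 / 2) ^ (k + 1)) (by positivity) hr1 x {x} (by
    intro y hy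
    exact ⟨x, by simp, by simpa using hy⟩)
  simp only [Finset.card_singleton, Nat.cast_one] at this
  convert this using 1
  rw [mul_assoc, ← Real.rpow_add two_pos, ← Real.rpow_natCast, ← Real.rpow_mul (by norm_num),
    one_div, Real.inv_rpow two_pos.le, ← Real.rpow_neg two_pos.le]
  congr 2; push_cast; ring

theorem normalizedLowerSpectrum_eq_iSup (X : Type*) [MetricSpace X] [Nonempty X]
    (θ : Set.Ioc (0 : ℝ) 1) :
    normalizedLowerSpectrum X θ = ⨆ (t : ℝ≥0) (_ : Admissible X θ t), (t : ℝ≥0∞) := by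
  obtain ⟨θ, hθ0, hθ1⟩ := θ
  unfold normalizedLowerSpectrum
  simp only
  split_ifs with h
  · subst h
    symm
    rw [← nonpos_iff_eq_zero]
    refine iSup₂_le fun t ht => ?_
    have : t = 0 := by
      have := admissible_one_nonpos ht
      exact le_antisymm (by exact_mod_cast this) zero_le
    simp [this]
  · have hlt : 0 < 1 - θ := by
      have := lt_of_le_of_ne hθ1 h
      linarith
    unfold lowerSpectrum
    simp only [lowerSpectrum_condition_iff, ENNReal.mul_iSup]
    obtain ⟨u, hu⟩ : ∃ u : ℝ≥0, (u : ℝ) = 1 - θ := ⟨⟨1 - θ, hlt.le⟩, rfl⟩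
    rw [← hu] at hlt ⊢
    have hu0 : 0 < u := by exact_mod_cast hlt
    simp only [ENNReal.ofReal_coe_nnreal]
    apply le_antisymm
    · refine iSup₂_le fun s hs => ?_
      refine le_iSup₂_of_le (u * s) (by simpa using hs) (by simp)
    · refine iSup₂_le fun t ht => ?_
      refine le_iSup₂_of_le (u⁻¹ * t) ?_ ?_
      · push_cast
        rwa [mul_inv_cancel_left₀ hlt.ne']
      · rw [← ENNReal.coe_mul, mul_inv_cancel_left₀ hu0.ne']

/-! ### Separated sets and covers in Euclidean space -/

/-- A set with boundedly many `δ`-separated points has a `δ`-separated finite `δ`-cover. -/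
theorem exists_separated_cover {X : Type*} [MetricSpace X] (E : Set X) (δ : ℝ) (M : ℕ)
    (h : ∀ P : Finset X, ↑P ⊆ E → (∀ p ∈ P, ∀ q ∈ P, p ≠ q → δ < dist p q) → P.card ≤ M)
    (hδ : 0 ≤ δ) :
    ∃ P : Finset X, ↑P ⊆ E ∧ (∀ p ∈ P, ∀ q ∈ P, p ≠ q → δ < dist p q) ∧ IsBallCover P E δ := by
  classical
  let S : Set ℕ := {n | ∃ P : Finset X, ↑P ⊆ E ∧
    (∀ p ∈ P, ∀ q ∈ P, p ≠ q → δ < dist p q) ∧ P.card = n}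
  have hS : S.Nonempty := ⟨0, ∅, by simp⟩
  have hb : BddAbove S := ⟨M, by rintro n ⟨P, h1, h2, rfl⟩; exact h P h1 h2⟩
  -- A separated set of maximal cardinality is a cover, since an uncovered point could be added.
  obtain ⟨P, h1, h2, h3⟩ := Nat.sSup_mem hS hb
  refine ⟨P, h1, h2, fun x hx => ?_⟩
  by_contra! hne
  have hxP : x ∉ P := fun hxP => by
    have := hne x hxP
    rw [dist_self] at this
    linarith
  have : (insert x P).card ∈ S := by
    refine ⟨insert x P, ?_, ?_, rfl⟩
    · simpa [Set.insert_subset_iff] using ⟨hx, h1⟩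
    · intro p hp q hq hpq
      rcases Finset.mem_insert.1 hp with rfl | hp' <;> rcases Finset.mem_insert.1 hq with rfl | hq'
      · exact absurd rfl hpq
      · exact hne q hq'
      · rw [dist_comm]; exact hne p hp'
      · exact h2 p hp' q hq' hpq
  have := le_csSup hb this
  rw [Finset.card_insert_of_notMem hxP] at this
  omega

theorem euclidean_dist_le_of_forall {d : ℕ} {x y : EuclideanSpace ℝ (Fin d)} {h : ℝ}
    (hxy : ∀ i, |x i - y i| ≤ h) : dist x y ≤ d * h := by
  rcases Nat.eq_zero_or_pos d with rfl | hd
  · simp [EuclideanSpace.dist_eq]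
  have hh : 0 ≤ h := (abs_nonneg _).trans (hxy ⟨0, hd⟩)
  rw [EuclideanSpace.dist_eq]
  apply Real.sqrt_le_iff.2 ⟨by positivity, ?_⟩
  calc ∑ i, dist (x i) (y i) ^ 2 ≤ ∑ _i : Fin d, h ^ 2 := by
        refine Finset.sum_le_sum fun i _ => ?_
        rw [Real.dist_eq]
        exact pow_le_pow_left₀ (abs_nonneg _) (hxy i) 2
    _ = d * h ^ 2 := by simp
    _ ≤ (d * h) ^ 2 := by
      rw [mul_pow]
      have : (1 : ℝ) ≤ d := by exact_mod_cast hd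
      have : (d : ℝ) ≤ d ^ 2 := by nlinarith
      gcongr

theorem euclidean_abs_sub_le_dist {d : ℕ} (x y : EuclideanSpace ℝ (Fin d)) (i : Fin d) :
    |x i - y i| ≤ dist x y := by
  rw [dist_eq_norm]
  simpa using PiLp.norm_apply_le (x - y) i

/-- The number of `r`-separated points in a ball of radius `ρ` of a Euclidean space. -/
theorem card_le_of_separated_euclidean {d : ℕ} (x : EuclideanSpace ℝ (Fin d)) {ρ r : ℝ} (hr : 0 < r)
    (hrρ : r ≤ ρ) (P : Finset (EuclideanSpace ℝ (Fin d))) (hP : ∀ p ∈ P, dist p x ≤ ρ)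
    (hsep : ∀ p ∈ P, ∀ q ∈ P, p ≠ q → r < dist p q) :
    (P.card : ℝ) ≤ ((2 * d + 4) * (ρ / r)) ^ d := by
  classical
  -- Grid cells of this mesh have diameter at most d h ≤ r, so each contains at most one point of
  -- `P`.
  set h : ℝ := r / (d + 1) with hh
  have hpos : 0 < h := by positivity
  let B : Finset (Fin d → ℤ) := Fintype.piFinset fun i =>
    Finset.Icc ⌊(x i - ρ) / h⌋ ⌊(x i + ρ) / h⌋
  let g : EuclideanSpace ℝ (Fin d) → (Fin d → ℤ) := fun p i => ⌊p i / h⌋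
  have hcard : P.card ≤ B.card := by
    refine Finset.card_le_card_of_injOn g ?_ ?_
    · intro p hp
      simp only [B, Fintype.coe_piFinset, Set.mem_pi, Finset.coe_Icc, Set.mem_Icc, g]
      intro i _
      have h1 := abs_le.1 ((euclidean_abs_sub_le_dist p x i).trans (hP p hp))
      constructor
      · exact Int.floor_le_floor (div_le_div_of_nonneg_right (by linarith) hpos.le)
      · exact Int.floor_le_floor (div_le_div_of_nonneg_right (by linarith) hpos.le)
    · intro p hp q hq hpq
      by_contra hne
      have h1 : dist p q ≤ d * h := by
        refine euclidean_dist_le_of_forall fun i => ?_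
        have h2 := Int.abs_sub_lt_one_of_floor_eq_floor (congrFun hpq i)
        rw [← sub_div, abs_div, abs_of_pos hpos, div_lt_one hpos] at h2
        exact h2.le
      have h2 := hsep p hp q hq hne
      have h3 : d * h ≤ r := by
        rw [hh, mul_div_assoc', div_le_iff₀ (by positivity)]
        nlinarith
      linarith
  have hB : (B.card : ℝ) ≤ ((2 * d + 4) * (ρ / r)) ^ d := by
    rw [Fintype.card_piFinset]
    push_cast
    calc ∏ i : Fin d, ((Finset.Icc ⌊(x i - ρ) / h⌋ ⌊(x i + ρ) / h⌋).card : ℝ)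
        ≤ ∏ _i : Fin d, ((2 * d + 4) * (ρ / r)) := by
          refine Finset.prod_le_prod (fun _ _ => by positivity) fun i _ => ?_
          rw [Int.card_Icc]
          have hle : ⌊(x i - ρ) / h⌋ ≤ ⌊(x i + ρ) / h⌋ :=
            Int.floor_le_floor (div_le_div_of_nonneg_right (by linarith) hpos.le)
          have : (((⌊(x i + ρ) / h⌋ + 1 - ⌊(x i - ρ) / h⌋).toNat : ℕ) : ℝ) =
              ⌊(x i + ρ) / h⌋ + 1 - ⌊(x i - ρ) / h⌋ := by
            have h0 : (0 : ℤ) ≤ ⌊(x i + ρ) / h⌋ + 1 - ⌊(x i - ρ) / h⌋ := by omega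
            have := Int.toNat_of_nonneg h0
            exact_mod_cast congrArg (fun z : ℤ => (z : ℝ)) this
          rw [this]
          have h1 := Int.floor_le ((x i + ρ) / h)
          have h2 := Int.lt_floor_add_one ((x i - ρ) / h)
          have h3 : (x i + ρ) / h - (x i - ρ) / h = 2 * (d + 1) * (ρ / r) := by
            rw [hh]; field_simp; ring
          have h4 : 1 ≤ ρ / r := (one_le_div hr).2 hrρ
          nlinarith
      _ = _ := by simp
  exact (by exact_mod_cast hcard : (P.card : ℝ) ≤ B.card).trans hB

/-- Centres must lie in `F`, so the cover is a maximal separated subset of the ball, counted in the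
ambient space. -/
theorem exists_ballCover_card_le {d : ℕ} (F : Set (EuclideanSpace ℝ (Fin d))) (x : F) {ρ r : ℝ}
    (hr : 0 < r) (hrρ : r ≤ ρ) :
    ∃ T : Finset F, IsBallCover T (Metric.closedBall x ρ) r ∧
      (T.card : ℝ) ≤ ((2 * d + 4) * (ρ / r)) ^ d := by
  classical
  have key : ∀ P : Finset F, ↑P ⊆ Metric.closedBall x ρ →
      (∀ p ∈ P, ∀ q ∈ P, p ≠ q → r < dist p q) →
      (P.card : ℝ) ≤ ((2 * d + 4) * (ρ / r)) ^ d := by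
    intro P h1 h2
    have := card_le_of_separated_euclidean (x : EuclideanSpace ℝ (Fin d)) hr hrρ
      (P.map (Function.Embedding.subtype _)) (by
        intro p hp
        obtain ⟨q, hq, rfl⟩ := Finset.mem_map.1 hp
        exact h1 hq) (by
        intro p hp q hq hpq
        obtain ⟨p', hp', rfl⟩ := Finset.mem_map.1 hp
        obtain ⟨q', hq', rfl⟩ := Finset.mem_map.1 hq
        exact h2 p' hp' q' hq' (fun h => hpq (by rw [h])))
    simpa using this
  obtain ⟨P, h1, h2, h3⟩ := exists_separated_cover (Metric.closedBall x ρ) r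
    ⌊((2 * d + 4) * (ρ / r)) ^ d⌋₊ (fun P h1 h2 => Nat.le_floor (key P h1 h2)) hr.le
  exact ⟨P, h3, key P h1 h2⟩

theorem exists_refined_ballCover {d : ℕ} {F : Set (EuclideanSpace ℝ (Fin d))} {E : Set F}
    {T : Finset F} {s r : ℝ} (hr : 0 < r) (hrs : r ≤ s) (hT : IsBallCover T E s) :
    ∃ T' : Finset F, IsBallCover T' E r ∧
      (T'.card : ℝ) ≤ T.card * ((2 * d + 4) * (s / r)) ^ d := by
  classical
  choose g hg1 hg2 using fun y : F => exists_ballCover_card_le F y hr hrs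
  refine ⟨T.biUnion g, fun x hx => ?_, ?_⟩
  · obtain ⟨y, hy, hxy⟩ := hT x hx
    obtain ⟨z, hz, hxz⟩ := hg1 y x hxy
    exact ⟨z, Finset.mem_biUnion.2 ⟨y, hy, hz⟩, hxz⟩
  · calc ((T.biUnion g).card : ℝ) ≤ ∑ y ∈ T, ((g y).card : ℝ) := by
          exact_mod_cast Finset.card_biUnion_le
      _ ≤ ∑ _y ∈ T, ((2 * d + 4) * (s / r)) ^ d := Finset.sum_le_sum fun y _ => hg2 y
      _ = _ := by simp

/-! ### Necessity of the inequalities -/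

theorem Admissible.le_dimension {d : ℕ} {F : Set (EuclideanSpace ℝ (Fin d))} (hF : F.Nonempty)
    {θ t : ℝ} (hθ : θ ≤ 1) (h : Admissible F θ t) : t ≤ (1 - θ) * d := by
  obtain ⟨C, hC, h⟩ := h
  obtain ⟨x, hx⟩ := hF
  suffices hs : t - (1 - θ) * d ≤ 0 by linarith
  refine nonpos_of_forall_rpow_le (C := C * 2 ^ (t - (1 - θ) * d)) (K := (2 * d + 4) ^ d)
    (by positivity) fun k => ?_
  have hr1 : ((2 : ℝ) ^ (-(k + 1 : ℝ))) < 1 :=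
    Real.rpow_lt_one_of_one_lt_of_neg one_lt_two (by linarith [Nat.cast_nonneg (α := ℝ) k])
  set r : ℝ := 2 ^ (-(k + 1 : ℝ)) with hr
  have hr0 : 0 < r := by positivity
  obtain ⟨T, hT, hcard⟩ := exists_ballCover_card_le F ⟨x, hx⟩ hr0
    (Real.self_le_rpow_of_le_one hr0.le hr1.le hθ)
  have h1 := (h r hr0 hr1 _ T hT).trans hcard
  have h2 : ((r ^ θ / r) ^ d : ℝ) = r ^ ((θ - 1) * d) := by
    rw [← Real.rpow_sub_one hr0.ne', ← Real.rpow_natCast, ← Real.rpow_mul hr0.le]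
  rw [mul_pow, h2, ← le_div_iff₀ (by positivity), mul_div_assoc, ← Real.rpow_sub hr0] at h1
  rw [hr, ← Real.rpow_mul two_pos.le] at h1
  rw [mul_assoc, ← Real.rpow_add two_pos, ← le_div_iff₀ (by positivity), div_eq_mul_inv,
    ← Real.rpow_neg two_pos.le]
  convert h1 using 3
  ring

/-- Upper bound in passing from scale `λθ` to `λ`. -/
theorem Admissible.of_mul {d : ℕ} {F : Set (EuclideanSpace ℝ (Fin d))} {l θ c : ℝ}
    (hθ0 : 0 < θ) (hθ : θ ≤ 1) (h : Admissible F (l * θ) c) :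
    Admissible F l ((c - (1 - θ) * d) / θ) := by
  obtain ⟨C, hC, h⟩ := h
  refine ⟨C / (2 * d + 4) ^ d, by positivity, fun s hs hs1 x T hT => ?_⟩
  -- Then r^θ = s, and the ball of radius s^l is the ball of radius r^{lθ}.
  set r : ℝ := s ^ (1 / θ) with hr
  have hr0 : 0 < r := by positivity
  have hr1 : r < 1 := Real.rpow_lt_one hs.le hs1 (by positivity)
  have hrs : r ≤ s := Real.rpow_le_self_of_le_one hs.le hs1.le ((one_le_div hθ0).2 hθ)
  obtain ⟨T', hT', hcard⟩ := exists_refined_ballCover hr0 hrs hT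
  have hrl : r ^ (l * θ) = s ^ l := by
    rw [hr, ← Real.rpow_mul hs.le]; congr 1; field_simp
  have h1 := (h r hr0 hr1 x T' (by rwa [hrl])).trans hcard
  have h2 : r ^ (-c) = s ^ (-(c / θ)) := by
    rw [hr, ← Real.rpow_mul hs.le]; congr 1; field_simp
  have h3 : (s / r) ^ d = s ^ ((1 - 1 / θ) * d) := by
    rw [Real.rpow_mul hs.le, Real.rpow_natCast, Real.rpow_sub hs, Real.rpow_one]
  rw [mul_pow, h2, h3, ← mul_assoc, ← div_le_iff₀ (by positivity), mul_div_assoc,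
    ← Real.rpow_sub hs] at h1
  rw [div_mul_eq_mul_div, div_le_iff₀ (by positivity)]
  convert h1 using 3
  field_simp
  ring

/-- Centres used for the s-ball at `p` lie within s + r ≤ 2s of `p`; separation 4s makes these
families disjoint. -/
theorem card_mul_le_of_separated {X : Type*} [MetricSpace X] {P T : Finset X} {E : Set X}
    {s r a : ℝ} (hrs : r ≤ s) (hT : IsBallCover T E r)
    (hP : ∀ p ∈ P, Metric.closedBall p s ⊆ E)
    (hsep : ∀ p ∈ P, ∀ q ∈ P, p ≠ q → 4 * s < dist p q)
    (ha : ∀ p ∈ P, ∀ T' : Finset X, IsBallCover T' (Metric.closedBall p s) r → a ≤ T'.card) :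
    P.card * a ≤ T.card := by
  classical
  let g : X → Finset X := fun p => T.filter fun y => dist y p ≤ s + r
  have hdisj : ∀ p ∈ P, ∀ q ∈ P, p ≠ q → Disjoint (g p) (g q) := by
    intro p hp q hq hpq
    rw [Finset.disjoint_left]
    intro y hy hy'
    have h1 := (Finset.mem_filter.1 hy).2
    have h2 := (Finset.mem_filter.1 hy').2
    have := hsep p hp q hq hpq
    have := dist_triangle_left p q y
    linarith
  have hcov : ∀ p ∈ P, IsBallCover (g p) (Metric.closedBall p s) r := by
    intro p hp x hx
    obtain ⟨y, hy, hxy⟩ := hT x (hP p hp hx)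
    refine ⟨y, Finset.mem_filter.2 ⟨hy, ?_⟩, hxy⟩
    have := dist_triangle_left y p x
    have := Metric.mem_closedBall.1 hx
    linarith
  calc (P.card : ℝ) * a = ∑ _p ∈ P, a := by simp
    _ ≤ ∑ p ∈ P, ((g p).card : ℝ) := Finset.sum_le_sum fun p hp => ha p hp _ (hcov p hp)
    _ = ((P.biUnion g).card : ℝ) := by rw [Finset.card_biUnion hdisj]; push_cast; rfl
    _ ≤ T.card := by
      exact_mod_cast Finset.card_le_card
        (Finset.biUnion_subset.2 fun p _ => Finset.filter_subset _ _)

theorem Admissible.mono {X : Type*} [MetricSpace X] {θ t t' : ℝ} (h : Admissible X θ t)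
    (ht : t' ≤ t) : Admissible X θ t' := by
  obtain ⟨C, hC, h⟩ := h
  refine ⟨C, hC, fun r hr hr1 x T hT => le_trans ?_ (h r hr hr1 x T hT)⟩
  gcongr C * ?_
  exact Real.rpow_le_rpow_of_exponent_ge hr hr1.le (by linarith)

/-- Superadditivity of admissible exponents. -/
theorem Admissible.add_mul {d : ℕ} {F : Set (EuclideanSpace ℝ (Fin d))} (hF : F.Nonempty)
    {l θ a b : ℝ} (hl0 : 0 < l) (hl : l ≤ 1) (hθ0 : 0 < θ) (hθ : θ ≤ 1) (ha0 : 0 ≤ a) (hb0 : 0 ≤ b)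
    (ha : Admissible F θ a) (hb : Admissible F l b) : Admissible F (l * θ) (a + θ * b) := by
  classical
  have : Nonempty F := hF.to_subtype
  rcases hl.eq_or_lt with rfl | hl
  · rw [one_mul]
    exact ha.mono (by nlinarith [admissible_one_nonpos hb])
  obtain ⟨A, hA, ha⟩ := ha
  obtain ⟨B, hB, hb⟩ := hb
  -- With s' = s/κ one has s'^l = s^l/2, leaving room for s-balls centred in B(x, s'^l) to stay
  -- inside B(x, s^l).
  set κ : ℝ := 2 ^ (1 / l) with hκ
  have hκ1 : 1 ≤ κ := Real.one_le_rpow one_le_two (by positivity)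
  set K : ℝ := ((2 * d + 4) * (4 * κ)) ^ d with hK
  have hK0 : 0 < K := by positivity
  -- This threshold gives s^{1-l} ≤ 1/2, that is, s ≤ s^l/2.
  refine admissible_of_small (r₀ := 2 ^ (-(1 / (θ * (1 - l))))) (C := A * (B / K)) (by positivity)
    (by positivity) (by positivity) fun r hr hr1 hrr x T hT => ?_
  set s : ℝ := r ^ θ with hs
  have hs0 : 0 < s := by positivity
  have hs1 : s < 1 := Real.rpow_lt_one hr.le hr1 hθ0
  have hrs : r ≤ s := Real.self_le_rpow_of_le_one hr.le hr1.le hθ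
  have hρ : r ^ (l * θ) = s ^ l := by rw [hs, ← Real.rpow_mul hr.le, mul_comm]
  rw [hρ] at hT
  have hsρ : s ≤ s ^ l / 2 := by
    have h1 : s ^ (1 - l) ≤ 1 / 2 := by
      calc s ^ (1 - l) = r ^ (θ * (1 - l)) := by rw [hs, ← Real.rpow_mul hr.le]
        _ ≤ (2 ^ (-(1 / (θ * (1 - l))))) ^ (θ * (1 - l)) := by
          have : 0 < 1 - l := by linarith
          gcongr
        _ = 1 / 2 := by
          have : 0 < 1 - l := by linarith
          rw [← Real.rpow_mul two_pos.le, neg_mul, one_div_mul_cancel (by positivity),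
            Real.rpow_neg_one, one_div]
    have h2 : s = s ^ l * s ^ (1 - l) := by
      rw [← Real.rpow_add hs0]; simp
    have h3 : 0 < s ^ l := by positivity
    nlinarith
  set s' : ℝ := s / κ with hs'
  have hs'0 : 0 < s' := by positivity
  have hs's : s' ≤ s := div_le_self hs0.le hκ1
  have hs'l : s' ^ l = s ^ l / 2 := by
    rw [hs', Real.div_rpow hs0.le (by positivity), hκ, ← Real.rpow_mul two_pos.le,
      one_div_mul_cancel hl0.ne', Real.rpow_one]
  have hsub : ∀ p ∈ Metric.closedBall x (s' ^ l), Metric.closedBall p s ⊆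
      Metric.closedBall x (s ^ l) := by
    intro p hp
    refine Metric.closedBall_subset_closedBall' ?_
    have := Metric.mem_closedBall.1 hp
    rw [hs'l] at this
    linarith
  have hArpos : 0 < A * r ^ (-a) := by positivity
  have hmul : ∀ P : Finset F, ↑P ⊆ Metric.closedBall x (s' ^ l) →
      (∀ p ∈ P, ∀ q ∈ P, p ≠ q → 4 * s < dist p q) → P.card * (A * r ^ (-a)) ≤ T.card :=
    fun P h1 h2 => card_mul_le_of_separated hrs hT (fun p hp => hsub p (h1 hp)) h2
      fun p _ T' hT' => ha r hr hr1 p T' hT'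
  -- The finite cover `T` bounds every packing. The resulting `P` is both 4s-separated and a
  -- 4s-cover, and refining it to scale s' costs the factor `K`.
  obtain ⟨P, hP1, hP2, hP3⟩ := exists_separated_cover (Metric.closedBall x (s' ^ l)) (4 * s)
    ⌊T.card / (A * r ^ (-a))⌋₊
    (fun P h1 h2 => Nat.le_floor ((le_div_iff₀ hArpos).2 (hmul P h1 h2))) (by positivity)
  obtain ⟨Q, hQ1, hQ2⟩ := exists_refined_ballCover hs'0 (by linarith) hP3
  have h1 := hb s' hs'0 (hs's.trans_lt hs1) x Q hQ1
  have h2 : (2 * d + 4) * (4 * s / s') = (2 * d + 4) * (4 * κ) := by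
    rw [hs']; field_simp
  rw [h2, ← hK] at hQ2
  have h3 : s ^ (-b) ≤ s' ^ (-b) :=
    Real.rpow_le_rpow_of_nonpos hs'0 hs's (by linarith)
  have h4 : B / K * s ^ (-b) ≤ P.card := by
    rw [div_mul_eq_mul_div, div_le_iff₀ hK0]
    exact (mul_le_mul_of_nonneg_left h3 hB.le).trans (h1.trans hQ2)
  calc A * (B / K) * r ^ (-(a + θ * b)) = (B / K * s ^ (-b)) * (A * r ^ (-a)) := by
        rw [hs, ← Real.rpow_mul hr.le, neg_add, Real.rpow_add hr, mul_neg]; ring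
    _ ≤ P.card * (A * r ^ (-a)) := by gcongr
    _ ≤ T.card := hmul P hP1 hP2

/-- The normalized lower spectrum of a subset of Euclidean space belongs to `classH`. -/
theorem exists_mem_classH_normalizedLowerSpectrum {d : ℕ} {F : Set (EuclideanSpace ℝ (Fin d))}
    (hF : F.Nonempty) : ∃ φ ∈ classH (d : ℝ), ∀ θ : Set.Ioc (0 : ℝ) 1,
      normalizedLowerSpectrum F θ = ENNReal.ofReal (φ θ : ℝ) := by
  have : Nonempty F := hF.to_subtype
  let S : ℝ → Set ℝ := fun θ => {t | 0 ≤ t ∧ Admissible F θ t}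
  have h0 : ∀ θ, (0 : ℝ) ∈ S θ := fun θ => ⟨le_rfl, admissible_zero F θ⟩
  have hub : ∀ θ ≤ 1, ∀ t ∈ S θ, t ≤ (1 - θ) * d := fun θ hθ t ht => ht.2.le_dimension hF hθ
  have hbdd : ∀ θ ≤ 1, BddAbove (S θ) := fun θ hθ => ⟨_, hub θ hθ⟩
  have hmem : ∀ θ : Set.Ioc (0 : ℝ) 1, sSup (S θ) ∈ Set.Icc (0 : ℝ) d := by
    rintro ⟨θ, hθ0, hθ1⟩
    refine ⟨le_csSup (hbdd θ hθ1) (h0 θ), (csSup_le ⟨0, h0 θ⟩ (hub θ hθ1)).trans ?_⟩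
    have : (0 : ℝ) ≤ d := by positivity
    nlinarith
  refine ⟨fun θ => ⟨sSup (S θ), hmem θ⟩, ⟨?_, ?_⟩, ?_⟩
  · rintro ⟨l, hl0, hl1⟩ ⟨θ, hθ0, hθ1⟩
    change sSup (S θ) + θ * sSup (S l) ≤ sSup (S (l * θ))
    have key : ∀ a ∈ S θ, ∀ b ∈ S l, a + θ * b ≤ sSup (S (l * θ)) := fun a ha b hb =>
      le_csSup (hbdd _ (by nlinarith)) ⟨add_nonneg ha.1 (mul_nonneg hθ0.le hb.1),
        ha.2.add_mul hF hl0 hl1 hθ0 hθ1 ha.1 hb.1 hb.2⟩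
    have h1 : ∀ b ∈ S l, b ≤ (sSup (S (l * θ)) - sSup (S θ)) / θ := by
      intro b hb
      rw [le_div_iff₀ hθ0]
      have : sSup (S θ) ≤ sSup (S (l * θ)) - θ * b :=
        csSup_le ⟨0, h0 θ⟩ fun a ha => by linarith [key a ha b hb]
      linarith
    have := csSup_le ⟨0, h0 l⟩ h1
    rw [le_div_iff₀ hθ0] at this
    linarith
  · rintro ⟨l, hl0, hl1⟩ ⟨θ, hθ0, hθ1⟩
    change sSup (S (l * θ)) ≤ (1 - θ) * d + θ * sSup (S l)
    refine csSup_le ⟨0, h0 _⟩ fun c hc => ?_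
    have hnn : 0 ≤ θ * sSup (S l) := mul_nonneg hθ0.le (le_csSup (hbdd l hl1) (h0 l))
    -- In the first case the transferred exponent is not positive and the bound is trivial.
    rcases le_total c ((1 - θ) * d) with hle | hle
    · linarith
    · have := le_csSup (hbdd l hl1) (a := (c - (1 - θ) * d) / θ)
        ⟨div_nonneg (by linarith) hθ0.le, hc.2.of_mul hθ0 hθ1⟩
      rw [div_le_iff₀ hθ0] at this
      linarith
  · rintro ⟨θ, hθ0, hθ1⟩
    rw [normalizedLowerSpectrum_eq_iSup]
    change _ = ENNReal.ofReal (sSup (S θ))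
    apply le_antisymm
    · refine iSup₂_le fun t ht => ?_
      rw [ENNReal.le_ofReal_iff_toReal_le (by simp) (le_csSup (hbdd θ hθ1) (h0 θ))]
      exact le_csSup (hbdd θ hθ1) ⟨t.2, ht⟩
    · refine le_of_forall_lt fun c hc => ?_
      have hctop : c ≠ ⊤ := (hc.trans_le le_top).ne
      lift c to ℝ≥0 using hctop
      have hc' : (c : ℝ) < sSup (S θ) := by
        rw [ENNReal.lt_ofReal_iff_toReal_lt (by simp)] at hc
        exact hc
      obtain ⟨t, ht, hct⟩ := exists_lt_of_lt_csSup ⟨0, h0 θ⟩ hc'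
      refine lt_of_lt_of_le ?_ (le_iSup₂ (f := fun (t : ℝ≥0) (_ : Admissible F θ t) => (t : ℝ≥0∞))
        ⟨t, ht.1⟩ ht.2)
      exact ENNReal.coe_lt_coe.2 hct

/-! ### Binary digit sets on the line -/

theorem sum_half_pow_nonneg (T : Finset ℕ) : 0 ≤ ∑ i ∈ T, (1 / 2 : ℝ) ^ i :=
  Finset.sum_nonneg fun _ _ => by positivity

theorem sum_half_pow_le {T : Finset ℕ} {n : ℕ} (hT : ∀ i ∈ T, n < i) :
    ∑ i ∈ T, (1 / 2 : ℝ) ^ i ≤ (1 / 2) ^ n := by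
  have h1 : ∀ N : ℕ, n ≤ N →
      ∑ i ∈ Finset.Ioc n N, (1 / 2 : ℝ) ^ i = (1 / 2) ^ n - (1 / 2) ^ N := by
    intro N hN
    induction N, hN using Nat.le_induction with
    | base => simp
    | succ N hN ih => rw [Finset.sum_Ioc_succ_top hN, ih, pow_succ]; ring
  have hsub : T ⊆ Finset.Ioc n (n + T.sup id) := fun i hi =>
    Finset.mem_Ioc.2 ⟨hT i hi, (Finset.le_sup (f := id) hi).trans (Nat.le_add_left _ _)⟩
  refine (Finset.sum_le_sum_of_subset_of_nonneg hsub fun _ _ _ => by positivity).trans ?_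
  rw [h1 _ (Nat.le_add_right _ _)]
  have : (0 : ℝ) < (1 / 2) ^ (n + T.sup id) := by positivity
  linarith

/-- Multiplied by 2^n, the sums become integers with distinct binary expansions. -/
theorem half_pow_le_abs_sum_sub_sum {U U' : Finset ℕ} {n : ℕ} (hU : ∀ i ∈ U, i ≤ n)
    (hU' : ∀ i ∈ U', i ≤ n) (hne : U ≠ U') :
    (1 / 2 : ℝ) ^ n ≤ |∑ i ∈ U, (1 / 2 : ℝ) ^ i - ∑ i ∈ U', (1 / 2 : ℝ) ^ i| := by
  have hsum : ∀ W : Finset ℕ, (∀ i ∈ W, i ≤ n) →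
      ∑ i ∈ W, (1 / 2 : ℝ) ^ i = (1 / 2) ^ n * ((∑ k ∈ W.image (n - ·), 2 ^ k : ℕ) : ℝ) := by
    intro W hW
    rw [Finset.sum_image (fun i hi k hk h => by
      have := hW i hi; have := hW k hk; omega)]
    push_cast
    rw [Finset.mul_sum]
    refine Finset.sum_congr rfl fun i hi => ?_
    rw [pow_sub₀ _ two_ne_zero (hW i hi), one_div, inv_pow, inv_pow]
    field_simp
  have himg : U.image (n - ·) ≠ U'.image (n - ·) := by
    intro h
    apply hne
    have aux : ∀ W W' : Finset ℕ, (∀ i ∈ W, i ≤ n) → (∀ i ∈ W', i ≤ n) →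
        W.image (n - ·) = W'.image (n - ·) → W ⊆ W' := by
      intro W W' hW hW' h i hi
      have : n - i ∈ W'.image (n - ·) := h ▸ Finset.mem_image_of_mem _ hi
      obtain ⟨k, hk, hki⟩ := Finset.mem_image.1 this
      have := hW i hi; have := hW' k hk
      have : i = k := by omega
      exact this ▸ hk
    exact (aux U U' hU hU' h).antisymm (aux U' U hU' hU h.symm)
  have hnat : (∑ k ∈ U.image (n - ·), 2 ^ k : ℕ) ≠ ∑ k ∈ U'.image (n - ·), 2 ^ k :=
    fun h => himg (Finset.geomSum_injective le_rfl h)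
  rw [hsum U hU, hsum U' hU', ← mul_sub, abs_mul, abs_of_pos (by positivity)]
  have : (1 : ℝ) ≤ |((∑ k ∈ U.image (n - ·), 2 ^ k : ℕ) : ℝ) -
      ((∑ k ∈ U'.image (n - ·), 2 ^ k : ℕ) : ℝ)| := by
    have := Int.one_le_abs (sub_ne_zero.2 (Nat.cast_injective.ne hnat : ((_ : ℕ) : ℤ) ≠ _))
    exact_mod_cast this
  nlinarith [show (0 : ℝ) < (1 / 2) ^ n by positivity]

/-- The finite sums of powers `2 ^ (-i)` over positions `i` at which `c` jumps. -/
def digitSet (c : ℕ → ℕ) : Set ℝ :=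
  {x | ∃ T : Finset ℕ, (∀ i ∈ T, c (i - 1) < c i) ∧ x = ∑ i ∈ T, (1 / 2 : ℝ) ^ i}

theorem zero_mem_digitSet (c : ℕ → ℕ) : (0 : ℝ) ∈ digitSet c := ⟨∅, by simp⟩

theorem card_jumps {c : ℕ → ℕ} (hmono : Monotone c) (hstep : ∀ n, c (n + 1) ≤ c n + 1)
    {j n : ℕ} (hjn : j ≤ n) :
    ((Finset.Ioc j n).filter fun i => c (i - 1) < c i).card = c n - c j := by
  induction n, hjn using Nat.le_induction with
  | base => simp
  | succ n hn ih =>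
    have h1 : Finset.Ioc j (n + 1) = insert (n + 1) (Finset.Ioc j n) := by
      ext i; simp only [Finset.mem_Ioc, Finset.mem_insert]; omega
    rw [h1, Finset.filter_insert]
    have h2 := hmono hn
    have h3 := hmono (Nat.le_succ n)
    have h4 := hstep n
    simp only [Nat.add_sub_cancel]
    split_ifs with h
    · rw [Finset.card_insert_of_notMem (by simp), ih]; omega
    · rw [ih]; simp only [Nat.succ_eq_add_one] at h3; omega

/-- The finite sums of powers `2 ^ (-i)` over jumps `i` of `c` in `(j, n]`. -/
noncomputable def digitSums (c : ℕ → ℕ) (j n : ℕ) : Finset ℝ :=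
  ((Finset.Ioc j n).filter fun i => c (i - 1) < c i).powerset.image
    fun U => ∑ i ∈ U, (1 / 2 : ℝ) ^ i

theorem mem_digitSums {c : ℕ → ℕ} {j n : ℕ} {x : ℝ} : x ∈ digitSums c j n ↔
    ∃ U : Finset ℕ, (∀ i ∈ U, (j < i ∧ i ≤ n) ∧ c (i - 1) < c i) ∧
      ∑ i ∈ U, (1 / 2 : ℝ) ^ i = x := by
  simp [digitSums, Finset.subset_iff]

theorem digitSums_separated {c : ℕ → ℕ} {j n : ℕ} {x y : ℝ} (hx : x ∈ digitSums c j n)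
    (hy : y ∈ digitSums c j n) (hxy : x ≠ y) : (1 / 2 : ℝ) ^ n ≤ |x - y| := by
  obtain ⟨U, hU, rfl⟩ := mem_digitSums.1 hx
  obtain ⟨U', hU', rfl⟩ := mem_digitSums.1 hy
  exact half_pow_le_abs_sum_sub_sum (fun i hi => (hU i hi).1.2) (fun i hi => (hU' i hi).1.2)
    fun h => hxy (by rw [h])

theorem card_digitSums {c : ℕ → ℕ} (hmono : Monotone c) (hstep : ∀ n, c (n + 1) ≤ c n + 1)
    {j n : ℕ} (hjn : j ≤ n) : (digitSums c j n).card = 2 ^ (c n - c j) := by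
  rw [digitSums, Finset.card_image_of_injOn, Finset.card_powerset, card_jumps hmono hstep hjn]
  intro U hU U' hU' h
  by_contra hne
  have hle : ∀ W ∈ ((Finset.Ioc j n).filter fun i => c (i - 1) < c i).powerset,
      ∀ i ∈ W, i ≤ n := fun W hW i hi =>
    (Finset.mem_Ioc.1 (Finset.mem_filter.1 (Finset.mem_powerset.1 hW hi)).1).2
  have := half_pow_le_abs_sum_sub_sum (hle U hU) (hle U' hU') hne
  simp only at h
  rw [h, sub_self, abs_zero] at this
  exact absurd this (not_le.2 (by positivity))

/-- Keep the digits of `x` up to `j` and choose freely at the jumps in (j, n]; changing digits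
beyond `j` moves a point by at most 2^{-j}. -/
theorem exists_separated_digitSet {c : ℕ → ℕ} (hmono : Monotone c)
    (hstep : ∀ n, c (n + 1) ≤ c n + 1) {j n : ℕ} (hjn : j ≤ n) {x : ℝ} (hx : x ∈ digitSet c) :
    ∃ V : Finset ℝ, V.card = 2 ^ (c n - c j) ∧ (∀ v ∈ V, v ∈ digitSet c ∧ |v - x| ≤ (1 / 2) ^ j) ∧
      ∀ v ∈ V, ∀ w ∈ V, v ≠ w → (1 / 2 : ℝ) ^ n ≤ |v - w| := by
  obtain ⟨T, hT, rfl⟩ := hx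
  set b : ℝ := ∑ i ∈ T.filter (· ≤ j), (1 / 2 : ℝ) ^ i with hb
  refine ⟨(digitSums c j n).map (addLeftEmbedding b), ?_, ?_, ?_⟩
  · rw [Finset.card_map, card_digitSums hmono hstep hjn]
  · intro v hv
    obtain ⟨u, hu, rfl⟩ := Finset.mem_map.1 hv
    obtain ⟨U, hU, rfl⟩ := mem_digitSums.1 hu
    simp only [addLeftEmbedding_apply]
    constructor
    · refine ⟨T.filter (· ≤ j) ∪ U, ?_, ?_⟩
      · intro i hi
        rcases Finset.mem_union.1 hi with hi | hi
        · exact hT i (Finset.mem_filter.1 hi).1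
        · exact (hU i hi).2
      · rw [Finset.sum_union]
        rw [Finset.disjoint_left]
        intro i hi hi'
        have := (Finset.mem_filter.1 hi).2
        have := (hU i hi').1.1
        omega
    · have h1 := Finset.sum_filter_add_sum_filter_not T (· ≤ j) fun i => (1 / 2 : ℝ) ^ i
      rw [← h1, ← hb, add_sub_add_left_eq_sub]
      have h2 := sum_half_pow_le (T := U) (n := j) fun i hi => (hU i hi).1.1
      have h3 := sum_half_pow_le (T := T.filter fun i => ¬ i ≤ j) (n := j) fun i hi => by
        simpa using (Finset.mem_filter.1 hi).2
      have h4 := sum_half_pow_nonneg U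
      have h5 := sum_half_pow_nonneg (T.filter fun i => ¬ i ≤ j)
      rw [abs_le]
      constructor <;> linarith
  · intro v hv w hw hvw
    obtain ⟨u, hu, rfl⟩ := Finset.mem_map.1 hv
    obtain ⟨u', hu', rfl⟩ := Finset.mem_map.1 hw
    simp only [addLeftEmbedding_apply, add_sub_add_left_eq_sub] at hvw ⊢
    exact digitSums_separated hu hu' fun h => hvw (by rw [h])

theorem exists_separated_interval (e : ℝ) {j n : ℕ} (hjn : j ≤ n) :
    ∃ V : Finset ℝ, V.card = 2 ^ (n - j) ∧ (∀ v ∈ V, e ≤ v ∧ v ≤ e + (1 / 2) ^ j) ∧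
      ∀ v ∈ V, ∀ w ∈ V, v ≠ w → (1 / 2 : ℝ) ^ n ≤ |v - w| := by
  have hpos : (0 : ℝ) < (1 / 2) ^ n := by positivity
  have hsep : ∀ a b : ℕ, a ≠ b →
      (1 / 2 : ℝ) ^ n ≤ |(e + a * (1 / 2) ^ n) - (e + b * (1 / 2) ^ n)| := by
    intro a b hab
    rw [add_sub_add_left_eq_sub, ← sub_mul, abs_mul, abs_of_pos hpos]
    have : (1 : ℝ) ≤ |(a : ℝ) - b| := by
      have := Int.one_le_abs (sub_ne_zero.2 (Nat.cast_injective.ne hab : (a : ℤ) ≠ b))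
      exact_mod_cast this
    nlinarith
  refine ⟨(Finset.range (2 ^ (n - j))).image fun a : ℕ => e + a * (1 / 2 : ℝ) ^ n, ?_, ?_, ?_⟩
  · rw [Finset.card_image_of_injective, Finset.card_range]
    intro a b hab
    by_contra hne
    have := hsep a b hne
    simp only at hab
    rw [hab, sub_self, abs_zero] at this
    linarith
  · intro v hv
    obtain ⟨a, ha, rfl⟩ := Finset.mem_image.1 hv
    have ha' : (a : ℝ) ≤ 2 ^ (n - j) := by exact_mod_cast (Finset.mem_range.1 ha).le
    have h1 : (2 : ℝ) ^ (n - j) * (1 / 2) ^ n = (1 / 2) ^ j := by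
      rw [pow_sub₀ _ two_ne_zero hjn, one_div, inv_pow, inv_pow]; field_simp
    constructor
    · have : 0 ≤ (a : ℝ) * (1 / 2) ^ n := by positivity
      linarith
    · rw [← h1]; gcongr
  · intro v hv w hw hvw
    obtain ⟨a, -, rfl⟩ := Finset.mem_image.1 hv
    obtain ⟨b, -, rfl⟩ := Finset.mem_image.1 hw
    exact hsep a b fun h => hvw (by rw [h])

/-! ### Covering numbers of the block set -/

/-- Covers of a ball containing a separated product set have at least as many elements. -/
theorem prod_card_le_of_isBallCover {d : ℕ} {F : Set (EuclideanSpace ℝ (Fin d))} (x : F)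
    {ρ r δ a : ℝ} (V : Fin d → Finset ℝ)
    (hV : ∀ i, ∀ v ∈ V i, |v + a - x.1 i| ≤ δ) (hδ : d * δ ≤ ρ)
    (hsep : ∀ i, ∀ v ∈ V i, ∀ w ∈ V i, v ≠ w → 2 * r < |v - w|)
    (hF : ∀ g : Fin d → ℝ, (∀ i, g i ∈ V i) → WithLp.toLp 2 (fun i => g i + a) ∈ F)
    {T : Finset F} (hT : IsBallCover T (Metric.closedBall x ρ) r) :
    ∏ i, (V i).card ≤ T.card := by
  classical
  have key : ∀ g : Fin d → ℝ, (∀ i, g i ∈ V i) →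
      ∃ y ∈ T, dist (WithLp.toLp 2 (fun i => g i + a)) y.1 ≤ r := by
    intro g hg
    obtain ⟨y, hy, hxy⟩ := hT ⟨_, hF g hg⟩ (by
      rw [Metric.mem_closedBall]
      exact (euclidean_dist_le_of_forall fun i => hV i _ (hg i)).trans hδ)
    exact ⟨y, hy, hxy⟩
  rw [← Fintype.card_piFinset]
  -- Each grid point goes to a centre covering it; points sharing a centre are within 2r in every
  -- coordinate, hence equal.
  refine Finset.card_le_card_of_injOn
    (fun g => if h : ∀ i, g i ∈ V i then (key g h).choose else x) ?_ ?_
  · intro g hg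
    have hg' : ∀ i, g i ∈ V i := Fintype.mem_piFinset.1 hg
    simp only [dif_pos hg']
    exact (key g hg').choose_spec.1
  · intro g hg g' hg' h
    have hg1 : ∀ i, g i ∈ V i := Fintype.mem_piFinset.1 hg
    have hg1' : ∀ i, g' i ∈ V i := Fintype.mem_piFinset.1 hg'
    simp only [dif_pos hg1, dif_pos hg1'] at h
    have h1 := (key g hg1).choose_spec.2
    have h2 := (key g' hg1').choose_spec.2
    rw [← h] at h2
    funext i
    by_contra hne
    have h3 := hsep i _ (hg1 i) _ (hg1' i) hne
    have h4 := euclidean_abs_sub_le_dist (WithLp.toLp 2 (fun i => g i + a))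
      (WithLp.toLp 2 (fun i => g' i + a)) i
    have h5 := dist_triangle_right (WithLp.toLp 2 (fun i => g i + a))
      (WithLp.toLp 2 (fun i => g' i + a)) (key g hg1).choose.1
    simp only [add_sub_add_right_eq_sub] at h4
    linarith

/-- The union over `k` of the translates by `2k` of the product digit sets of `c k`, each placed at
a corner of a cube of full dimension and separated from it at scale `2 ^ (-(k + 1))`. -/
def blockSet (d : ℕ) (c : ℕ → ℕ → ℕ) : Set (EuclideanSpace ℝ (Fin d)) :=
  {x | ∃ k : ℕ, (∀ i, x i - 2 * k ∈ digitSet (c k)) ∨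
    ∀ i, x i - 2 * k ∈ Set.Icc ((1 / 2 : ℝ) ^ (k + 1)) 1}

theorem mem_Icc_of_mem_digitSet {c : ℕ → ℕ} {m : ℕ} (hm : ∀ n ≤ m, c n = 0) {x : ℝ}
    (hx : x ∈ digitSet c) : x ∈ Set.Icc (0 : ℝ) ((1 / 2) ^ m) := by
  obtain ⟨T, hT, rfl⟩ := hx
  refine ⟨sum_half_pow_nonneg T, sum_half_pow_le fun i hi => ?_⟩
  by_contra! h
  have := hT i hi
  rw [hm i h] at this
  omega

/-- Near the digit part of a block with k + 1 ≤ j, the ball sees all digits between levels `j` and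
`n`. Otherwise it contains a cube of side 2^{-(j+1)} lying in the solid part of the block. -/
theorem blockSet_card_le {d : ℕ} {c : ℕ → ℕ → ℕ} (hmono : ∀ k, Monotone (c k))
    (hstep : ∀ k n, c k (n + 1) ≤ c k n + 1) (hm : ∀ k, ∀ n ≤ k + 1, c k n = 0)
    {j n : ℕ} (hjn : j + 1 ≤ n) {r ρ : ℝ} (hρ : d * (1 / 2 : ℝ) ^ j ≤ ρ)
    (hr : 2 * r < (1 / 2) ^ n) (x : blockSet d c) {T : Finset (blockSet d c)}
    (hT : IsBallCover T (Metric.closedBall x ρ) r) :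
    (∃ k, k + 1 ≤ j ∧ 2 ^ ((c k n - c k j) * d) ≤ T.card) ∨ 2 ^ ((n - (j + 1)) * d) ≤ T.card := by
  obtain ⟨k, hx⟩ := x.2
  have hhalf : (1 / 2 : ℝ) ^ j = (1 / 2) ^ (j + 1) + (1 / 2) ^ (j + 1) := by rw [pow_succ]; ring
  have hpow : (1 / 2 : ℝ) ^ (j + 1) ≤ 1 / 2 := by
    rw [pow_succ]
    have : (1 / 2 : ℝ) ^ j ≤ 1 := pow_le_one₀ (by norm_num) (by norm_num)
    linarith
  have hfull : (∀ i, ∃ e, (1 / 2 : ℝ) ^ (k + 1) ≤ e ∧ e + (1 / 2) ^ (j + 1) ≤ 1 ∧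
      e - (x.1 i - 2 * k) ≤ (1 / 2) ^ (j + 1) ∧ (x.1 i - 2 * k) - e ≤ (1 / 2) ^ (j + 1)) →
      2 ^ ((n - (j + 1)) * d) ≤ T.card := by
    intro h
    choose e he1 he2 he3 he4 using h
    choose V hV1 hV2 hV3 using fun i => exists_separated_interval (e i) hjn
    have := prod_card_le_of_isBallCover x (δ := (1 / 2) ^ j) (a := 2 * k) V
      (by
        intro i v hv
        have h1 := hV2 i v hv
        rw [abs_le]
        constructor <;> linarith [h1.1, h1.2, he3 i, he4 i])
      hρ (fun i v hv w hw hvw => hr.trans_le (hV3 i v hv w hw hvw))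
      (fun g hg => ⟨k, Or.inr fun i => by
        have h1 := hV2 i _ (hg i)
        simp only [add_sub_cancel_right]
        exact ⟨(he1 i).trans h1.1, h1.2.trans (he2 i)⟩⟩) hT
    simpa [hV1, ← pow_mul] using this
  have hkpow : (1 / 2 : ℝ) ^ (k + 1) ≤ 1 / 2 := by
    rw [pow_succ]
    have : (1 / 2 : ℝ) ^ k ≤ 1 := pow_le_one₀ (by norm_num) (by norm_num)
    linarith
  rcases hx with hx' | hx'
  · rcases le_or_gt (k + 1) j with hkj | hkj
    · left
      refine ⟨k, hkj, ?_⟩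
      choose V hV1 hV2 hV3 using fun i =>
        exists_separated_digitSet (hmono k) (hstep k) (show j ≤ n by omega) (hx' i)
      have := prod_card_le_of_isBallCover x (δ := (1 / 2) ^ j) (a := 2 * k) V
        (by
          intro i v hv
          have h1 := (hV2 i v hv).2
          rwa [sub_sub_eq_add_sub] at h1)
        hρ (fun i v hv w hw hvw => hr.trans_le (hV3 i v hv w hw hvw))
        (fun g hg => ⟨k, Or.inl fun i => by
          simp only [add_sub_cancel_right]
          exact (hV2 i _ (hg i)).1⟩) hT
      simpa [hV1, ← pow_mul] using this
    · right
      have h1 : (1 / 2 : ℝ) ^ (k + 1) ≤ (1 / 2) ^ (j + 1) :=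
        pow_le_pow_of_le_one (by norm_num) (by norm_num) (by omega)
      -- The whole digit part lies in [0, 2^{-(k+1)}]^d, within 2^{-(j+1)} of the cube in each
      -- coordinate.
      refine hfull fun i => ⟨(1 / 2) ^ (k + 1), le_rfl, by linarith, ?_, ?_⟩
      · linarith [(mem_Icc_of_mem_digitSet (hm k) (hx' i)).1]
      · have : (0 : ℝ) < (1 / 2) ^ (j + 1) := by positivity
        linarith [(mem_Icc_of_mem_digitSet (hm k) (hx' i)).2]
  · right
    have hpos : (0 : ℝ) < (1 / 2) ^ (j + 1) := by positivity
    refine hfull fun i => ?_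
    rcases le_total (x.1 i - 2 * k) (1 / 2) with h | h
    · exact ⟨x.1 i - 2 * k, (hx' i).1, by linarith, by linarith, by linarith⟩
    · refine ⟨max (1 / 2) (x.1 i - 2 * k - (1 / 2) ^ (j + 1)),
        hkpow.trans (le_max_left _ _), ?_, ?_, ?_⟩
      · rw [← le_sub_iff_add_le]
        exact max_le (by linarith) (by linarith [(hx' i).2])
      · rw [sub_le_iff_le_add]
        exact max_le (by linarith) (by linarith)
      · linarith [le_max_right (1 / 2) (x.1 i - 2 * k - (1 / 2) ^ (j + 1))]

/-- A ball of radius 2^{-(k+2)} at the corner meets only the digit part of block `k`. Truncating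
digits at level `n` moves each coordinate by at most 2^{-n}, so the truncations are the centres. -/
theorem exists_blockSet_cover {d : ℕ} (hd : 0 < d) {c : ℕ → ℕ → ℕ} (hmono : ∀ k, Monotone (c k))
    (hstep : ∀ k n, c k (n + 1) ≤ c k n + 1) (hm : ∀ k, ∀ n ≤ k + 1, c k n = 0) (k n : ℕ)
    (hkn : k + 1 ≤ n) {r : ℝ} (hr : d * (1 / 2 : ℝ) ^ n ≤ r) :
    ∃ (x : blockSet d c) (T : Finset (blockSet d c)),
      IsBallCover T (Metric.closedBall x ((1 / 2) ^ (k + 2))) r ∧ T.card ≤ 2 ^ (c k n * d) := by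
  classical
  let p : blockSet d c := ⟨WithLp.toLp 2 fun _ => 2 * (k : ℝ), k, Or.inl fun i => by
    simpa using zero_mem_digitSet (c k)⟩
  let q : (Fin d → digitSums (c k) (k + 1) n) → blockSet d c := fun g =>
    ⟨WithLp.toLp 2 fun i => (g i : ℝ) + 2 * k, k, Or.inl fun i => by
      obtain ⟨U, hU, hUg⟩ := mem_digitSums.1 (g i).2
      exact ⟨U, fun i hi => (hU i hi).2, by simp [← hUg]⟩⟩
  refine ⟨p, Finset.univ.image q, ?_, ?_⟩
  · rintro ⟨y, l, hy⟩ hyp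
    have hdist : ∀ i, |y i - 2 * k| ≤ (1 / 2) ^ (k + 2) := fun i =>
      (euclidean_abs_sub_le_dist y p.1 i).trans (Metric.mem_closedBall.1 hyp)
    have hsmall : (1 / 2 : ℝ) ^ (k + 2) ≤ 1 / 4 := by
      rw [pow_add]
      have : (1 / 2 : ℝ) ^ k ≤ 1 := pow_le_one₀ (by norm_num) (by norm_num)
      linarith
    have h01 : ∀ i, y i - 2 * l ∈ Set.Icc (0 : ℝ) 1 := by
      intro i
      rcases hy with hy | hy
      · have h1 := mem_Icc_of_mem_digitSet (hm l) (hy i)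
        exact ⟨h1.1, h1.2.trans (pow_le_one₀ (by norm_num) (by norm_num))⟩
      · exact ⟨le_trans (by positivity) (hy i).1, (hy i).2⟩
    have hlk : l = k := by
      have h1 := abs_le.1 (hdist ⟨0, hd⟩)
      have h2 := h01 ⟨0, hd⟩
      have h3 : (l : ℝ) < k + 1 := by linarith [h2.1]
      have h4 : (k : ℝ) < l + 1 := by linarith [h2.2]
      have h5 : l < k + 1 := by exact_mod_cast h3
      have h6 : k < l + 1 := by exact_mod_cast h4
      omega
    subst hlk
    have hdig : ∀ i, y i - 2 * l ∈ digitSet (c l) := by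
      rcases hy with hy | hy
      · exact hy
      · have h1 := (abs_le.1 (hdist ⟨0, hd⟩)).2
        have h2 := (hy ⟨0, hd⟩).1
        have h3 : (1 / 2 : ℝ) ^ (l + 2) < (1 / 2) ^ (l + 1) :=
          pow_lt_pow_right_of_lt_one₀ (by norm_num) (by norm_num) (by omega)
        linarith
    choose W hW hWy using hdig
    have hg : ∀ i, ∑ a ∈ (W i).filter (· ≤ n), (1 / 2 : ℝ) ^ a ∈ digitSums (c l) (l + 1) n := by
      intro i
      refine mem_digitSums.2 ⟨_, fun a ha => ?_, rfl⟩
      obtain ⟨ha1, ha2⟩ := Finset.mem_filter.1 ha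
      refine ⟨⟨?_, ha2⟩, hW i a ha1⟩
      by_contra! h
      have := hW i a ha1
      rw [hm l a h] at this
      omega
    refine ⟨q fun i => ⟨_, hg i⟩, Finset.mem_image_of_mem _ (Finset.mem_univ _), ?_⟩
    refine le_trans (euclidean_dist_le_of_forall (h := (1 / 2) ^ n) fun i => ?_) hr
    have h1 := Finset.sum_filter_add_sum_filter_not (W i) (· ≤ n) fun a => (1 / 2 : ℝ) ^ a
    have h2 := sum_half_pow_le (T := (W i).filter fun a => ¬ a ≤ n) (n := n) fun a ha => by
      simpa using (Finset.mem_filter.1 ha).2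
    have h3 := sum_half_pow_nonneg ((W i).filter fun a => ¬ a ≤ n)
    have h4 := hWy i
    change |y i - (∑ a ∈ (W i).filter (· ≤ n), (1 / 2 : ℝ) ^ a + 2 * l)| ≤ _
    rw [abs_le]
    constructor <;> linarith
  · refine Finset.card_image_le.trans ?_
    rw [Finset.card_univ, Fintype.card_fun, Fintype.card_coe,
      card_digitSums (hmono k) (hstep k) hkn, hm k _ le_rfl, Fintype.card_fin, ← pow_mul,
      Nat.sub_zero]

/-! ### Growth between two scales and digit counts -/

/-- The inequalities defining `classH`, for a function of a real variable. -/
structure IsSpectrumProfile (d : ℝ) (f : ℝ → ℝ) : Prop where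
  nonneg : ∀ θ, 0 < θ → θ ≤ 1 → 0 ≤ f θ
  le : ∀ θ, 0 < θ → θ ≤ 1 → f θ ≤ (1 - θ) * d
  superadd : ∀ l θ, 0 < l → l ≤ 1 → 0 < θ → θ ≤ 1 → f θ + θ * f l ≤ f (l * θ)
  weakLip : ∀ l θ, 0 < l → l ≤ 1 → 0 < θ → θ ≤ 1 → f (l * θ) ≤ (1 - θ) * d + θ * f l

/-- The homogeneous two-parameter function associated with `f`. -/
noncomputable def scaleGrowth (f : ℝ → ℝ) (u v : ℝ) : ℝ := v * f (u / v)

namespace IsSpectrumProfile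

variable {d : ℝ} {f : ℝ → ℝ} {u v w : ℝ}

theorem scaleGrowth_nonneg (h : IsSpectrumProfile d f) (hu : 0 < u) (huv : u ≤ v) :
    0 ≤ scaleGrowth f u v := by
  have hv := hu.trans_le huv
  exact mul_nonneg hv.le (h.nonneg _ (by positivity) ((div_le_one hv).2 huv))

theorem scaleGrowth_self (h : IsSpectrumProfile d f) (hu : 0 < u) : scaleGrowth f u u = 0 := by
  have h1 := h.nonneg 1 one_pos le_rfl
  have h2 := h.le 1 one_pos le_rfl
  have : f 1 = 0 := by linarith
  rw [scaleGrowth, div_self hu.ne', this, mul_zero]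

/-- Superadditivity at l = u/v, θ = v/w, multiplied by w. -/
theorem scaleGrowth_add_le (h : IsSpectrumProfile d f) (hu : 0 < u) (huv : u ≤ v) (hvw : v ≤ w) :
    scaleGrowth f u v + scaleGrowth f v w ≤ scaleGrowth f u w := by
  have hv := hu.trans_le huv
  have hw := hv.trans_le hvw
  have := h.superadd (u / v) (v / w) (by positivity) ((div_le_one hv).2 huv) (by positivity)
    ((div_le_one hw).2 hvw)
  rw [div_mul_div_cancel₀ hv.ne'] at this
  have := mul_le_mul_of_nonneg_left this hw.le
  unfold scaleGrowth
  have h1 : w * (f (v / w) + v / w * f (u / v)) = v * f (u / v) + w * f (v / w) := by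
    field_simp; ring
  linarith

theorem scaleGrowth_mono (h : IsSpectrumProfile d f) (hu : 0 < u) (huv : u ≤ v) (hvw : v ≤ w) :
    scaleGrowth f u v ≤ scaleGrowth f u w := by
  linarith [h.scaleGrowth_add_le hu huv hvw, h.scaleGrowth_nonneg (hu.trans_le huv) hvw]

theorem scaleGrowth_le_add (h : IsSpectrumProfile d f) (hu : 0 < u) (huv : u ≤ v) (hvw : v ≤ w) :
    scaleGrowth f u w ≤ scaleGrowth f u v + d * (w - v) := by
  have hv := hu.trans_le huv
  have hw := hv.trans_le hvw
  have := h.weakLip (u / v) (v / w) (by positivity) ((div_le_one hv).2 huv) (by positivity)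
    ((div_le_one hw).2 hvw)
  rw [div_mul_div_cancel₀ hv.ne'] at this
  have := mul_le_mul_of_nonneg_left this hw.le
  unfold scaleGrowth
  have h1 : w * ((1 - v / w) * d + v / w * f (u / v)) = v * f (u / v) + d * (w - v) := by
    field_simp; ring
  linarith

theorem scaleGrowth_div (hu : 0 < u) (θ : ℝ) :
    scaleGrowth f u (u / θ) = u / θ * f θ := by
  rw [scaleGrowth, div_div_cancel₀ hu.ne']

end IsSpectrumProfile

/-- The number of branchings above level `n` in the `k`-th digit set. -/
noncomputable def branchCount (d : ℕ) (f : ℝ → ℝ) (k n : ℕ) : ℕ :=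
  ⌊scaleGrowth f (k + 1) (max n (k + 1) : ℕ) / d⌋₊

section branchCount

variable {d : ℕ} {f : ℝ → ℝ}

theorem branchCount_mono (h : IsSpectrumProfile d f) (k : ℕ) : Monotone (branchCount d f k) := by
  intro a b hab
  refine Nat.floor_mono (div_le_div_of_nonneg_right (h.scaleGrowth_mono (by positivity) ?_ ?_)
    (by positivity))
  · exact_mod_cast le_max_right _ _
  · exact_mod_cast max_le_max_right _ hab

/-- The weak Lipschitz bound lets the growth increase by at most d per level, that is, one bit per
coordinate. -/
theorem branchCount_step (hd : 0 < d) (h : IsSpectrumProfile d f) (k n : ℕ) :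
    branchCount d f k (n + 1) ≤ branchCount d f k n + 1 := by
  have hd' : (0 : ℝ) < d := by exact_mod_cast hd
  have h0 : ((k : ℝ) + 1) ≤ (max n (k + 1) : ℕ) := by exact_mod_cast le_max_right _ _
  have h1 : (max n (k + 1) : ℕ) ≤ max (n + 1) (k + 1) := max_le_max_right _ (Nat.le_succ n)
  have h2 : (max (n + 1) (k + 1) : ℕ) ≤ max n (k + 1) + 1 := by omega
  have h3 := h.scaleGrowth_le_add (by positivity) h0 (Nat.cast_le.2 h1)
  have h2' : ((max (n + 1) (k + 1) : ℕ) : ℝ) ≤ (max n (k + 1) : ℕ) + 1 := by exact_mod_cast h2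
  have h4 := h.scaleGrowth_nonneg (by positivity) h0
  unfold branchCount
  rw [← Nat.floor_add_one (by positivity)]
  refine Nat.floor_mono ?_
  rw [div_add_one hd'.ne']
  refine div_le_div_of_nonneg_right ?_ hd'.le
  nlinarith

/-- The maximum in `branchCount` freezes the count below level k + 1 at its value there, which is 0.
-/
theorem branchCount_eq_zero (h : IsSpectrumProfile d f) (k : ℕ) :
    ∀ n ≤ k + 1, branchCount d f k n = 0 := by
  intro n hn
  have := h.scaleGrowth_self (u := (k : ℝ) + 1) (by positivity)
  rw [branchCount, max_eq_right hn]
  push_cast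
  rw [this]
  simp

theorem branchCount_mul_le (hd : 0 < d) (h : IsSpectrumProfile d f) {k n : ℕ} (hn : k + 1 ≤ n) :
    (branchCount d f k n : ℝ) * d ≤ scaleGrowth f (k + 1) n := by
  have hd' : (0 : ℝ) < d := by exact_mod_cast hd
  rw [← le_div_iff₀ hd', branchCount, max_eq_left hn]
  exact Nat.floor_le (div_nonneg (h.scaleGrowth_nonneg (by positivity) (by exact_mod_cast hn))
    hd'.le)

theorem le_branchCount_mul (hd : 0 < d) {k n : ℕ} (hn : k + 1 ≤ n) :
    scaleGrowth f (k + 1) n ≤ (branchCount d f k n + 1) * d := by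
  have hd' : (0 : ℝ) < d := by exact_mod_cast hd
  rw [← div_le_iff₀ hd', branchCount, max_eq_left hn]
  exact (Nat.lt_floor_add_one _).le

/-- Superadditivity transfers growth measured from k + 1 to growth measured from `j`; the floor
loses at most one bit in each of the d coordinates. -/
theorem scaleGrowth_le_branchCount_sub (hd : 0 < d) (h : IsSpectrumProfile d f) {k j n : ℕ}
    (hj : k + 1 ≤ j) (hjn : j ≤ n) :
    scaleGrowth f j n ≤ ((branchCount d f k n - branchCount d f k j) * d : ℕ) + d := by
  have h1 := branchCount_mul_le hd h hj
  have h2 := le_branchCount_mul (f := f) hd (hj.trans hjn)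
  have h3 := h.scaleGrowth_add_le (u := (k : ℝ) + 1) (v := j) (w := n) (by positivity)
    (by exact_mod_cast hj) (by exact_mod_cast hjn)
  rw [Nat.cast_mul, Nat.cast_sub (branchCount_mono h k hjn)]
  linarith

end branchCount

/-! ### The lower spectrum of the block set -/

theorem half_pow_eq_rpow (n : ℕ) : (1 / 2 : ℝ) ^ n = 2 ^ (-(n : ℝ)) := by
  rw [Real.rpow_neg two_pos.le, Real.rpow_natCast, one_div, inv_pow]

theorem natCast_mul_half_pow_le {d n : ℕ} {a : ℝ} (h : a + d ≤ n) :
    (d : ℝ) * (1 / 2) ^ n ≤ 2 ^ (-a) := by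
  calc (d : ℝ) * (1 / 2) ^ n ≤ 2 ^ (d : ℝ) * 2 ^ (-(n : ℝ)) := by
        rw [half_pow_eq_rpow, Real.rpow_natCast]
        gcongr
        exact_mod_cast Nat.lt_two_pow_self.le
    _ = 2 ^ ((d : ℝ) - n) := by rw [← Real.rpow_add two_pos, sub_eq_add_neg]
    _ ≤ 2 ^ (-a) := Real.rpow_le_rpow_of_exponent_le one_le_two (by linarith)

/-- For r = 2^{-R} the relevant levels are j ≈ θR and n ≈ R, and G(θR, R) = R f(θ); all rounding
costs a bounded power of 2. -/
theorem admissible_blockSet {d : ℕ} (hd : 0 < d) {f : ℝ → ℝ} (h : IsSpectrumProfile d f) {θ : ℝ}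
    (hθ0 : 0 < θ) (hθ1 : θ ≤ 1) : Admissible (blockSet d (branchCount d f)) θ (f θ) := by
  -- The first summand pays for short level ranges and for the cube case, the second for the digit
  -- case.
  set K : ℝ := d * (d + 4) + d * (3 + (d + 1) / θ) with hK
  have hK1 : 0 ≤ (d : ℝ) * (d + 4) := by positivity
  have hK2 : 0 ≤ (d : ℝ) * (3 + (d + 1) / θ) := by positivity
  refine ⟨2 ^ (-K), by positivity, fun r hr hr1 x T hT => ?_⟩
  obtain ⟨R, hR, rfl⟩ : ∃ R : ℝ, 0 < R ∧ r = 2 ^ (-R) := by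
    refine ⟨-Real.logb 2 r, ?_, ?_⟩
    · exact neg_pos.2 (Real.logb_neg one_lt_two hr hr1)
    · rw [neg_neg, Real.rpow_logb two_pos (by norm_num) hr]
  have hgoal : ∀ N : ℕ, R * f θ - K ≤ N → 2 ^ N ≤ T.card →
      2 ^ (-K) * ((2 : ℝ) ^ (-R)) ^ (-f θ) ≤ T.card := by
    intro N hN hT
    rw [← Real.rpow_mul two_pos.le, ← Real.rpow_add two_pos]
    calc (2 : ℝ) ^ (-K + -R * -f θ) ≤ 2 ^ (N : ℝ) :=
          Real.rpow_le_rpow_of_exponent_le one_le_two (by linarith)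
      _ = ((2 ^ N : ℕ) : ℝ) := by rw [Real.rpow_natCast]; push_cast; rfl
      _ ≤ T.card := by exact_mod_cast hT
  have hf : R * f θ ≤ d * (R - θ * R) := by
    have := mul_le_mul_of_nonneg_left (h.le θ hθ0 hθ1) hR.le
    linarith
  rcases le_total R (θ * R + d + 4) with hsmall | hbig
  · refine hgoal 0 ?_ ?_
    · have : (d : ℝ) * (R - θ * R) ≤ d * (d + 4) := by gcongr; linarith
      push_cast
      linarith
    · have := one_le_card_of_isBallCover (by positivity) hT
      exact_mod_cast this
  -- The extra `d` levels absorb the factor d in d 2^{-j} ≤ r^θ, since d ≤ 2^d.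
  set j : ℕ := ⌈θ * R⌉₊ + d with hj
  have hθR : 0 ≤ θ * R := by positivity
  have hj1 : θ * R + d ≤ j := by
    rw [hj]; push_cast; linarith [Nat.le_ceil (θ * R)]
  have hj2 : (j : ℝ) ≤ θ * R + d + 1 := by
    rw [hj]; push_cast; linarith [Nat.ceil_lt_add_one hθR]
  obtain ⟨n, hn1, hn2⟩ : ∃ n : ℕ, R - 2 ≤ n ∧ n < R - 1 := by
    refine ⟨⌈R - 2⌉₊, Nat.le_ceil _, ?_⟩
    have : (0 : ℝ) ≤ d := by positivity
    linarith [Nat.ceil_lt_add_one (show 0 ≤ R - 2 by linarith)]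
  have hjn : j + 1 ≤ n := by
    have : ((j + 1 : ℕ) : ℝ) ≤ n := by push_cast; linarith
    exact_mod_cast this
  have hρ : (d : ℝ) * (1 / 2) ^ j ≤ ((2 : ℝ) ^ (-R)) ^ θ := by
    rw [← Real.rpow_mul two_pos.le, show -R * θ = -(θ * R) by ring]
    exact natCast_mul_half_pow_le hj1
  have hr2 : 2 * (2 : ℝ) ^ (-R) < (1 / 2) ^ n := by
    rw [half_pow_eq_rpow, ← Real.rpow_one_add' two_pos.le (by linarith)]
    exact Real.rpow_lt_rpow_of_exponent_lt one_lt_two (by linarith)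
  rcases blockSet_card_le (branchCount_mono h) (branchCount_step hd h) (branchCount_eq_zero h)
    hjn hρ hr2 x hT with ⟨k, hkj, hcard⟩ | hcard
  · refine hgoal _ ?_ hcard
    have hj0 : (0 : ℝ) < j := by
      have : 0 < j := by omega
      exact_mod_cast this
    have h1 := scaleGrowth_le_branchCount_sub hd h hkj (show j ≤ n by omega)
    have hjR : R ≤ j / θ := by rw [le_div_iff₀ hθ0]; linarith [(d.cast_nonneg : (0 : ℝ) ≤ d)]
    have hjR2 : j / θ ≤ R + (d + 1) / θ := by
      rw [div_le_iff₀ hθ0, add_mul, div_mul_cancel₀ _ hθ0.ne']; linarith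
    have hjn' : (j : ℝ) ≤ n := by exact_mod_cast (show j ≤ n by omega)
    -- At j/θ the growth is exactly (j/θ) f(θ); the weak Lipschitz bound pays if j/θ exceeds `n`.
    have h2 : scaleGrowth f j (j / θ) ≤ scaleGrowth f j n + d * (2 + (d + 1) / θ) := by
      have hnn : 0 ≤ (d : ℝ) * (2 + (d + 1) / θ) := by positivity
      rcases le_total (j / θ) n with hle | hle
      · have := h.scaleGrowth_mono hj0 (le_div_self hj0.le hθ0 hθ1) hle
        linarith
      · refine (h.scaleGrowth_le_add hj0 hjn' hle).trans ?_
        gcongr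
        linarith
    rw [IsSpectrumProfile.scaleGrowth_div hj0] at h2
    have h3 : R * f θ ≤ j / θ * f θ := mul_le_mul_of_nonneg_right hjR (h.nonneg θ hθ0 hθ1)
    linarith
  · refine hgoal _ ?_ hcard
    rw [Nat.cast_mul, Nat.cast_sub hjn]
    push_cast
    have : (d : ℝ) * (R - θ * R) ≤ d * ((n - (j + 1)) + (d + 4)) := by gcongr; linarith
    linarith

/-- Test at the corner of block k with r^θ = 2^{-(k+2)}: about 2^{(k+1)f(θ)/θ} balls suffice, and k
→ ∞ forces t ≤ f(θ). -/
theorem Admissible.le_of_blockSet {d : ℕ} (hd : 0 < d) {f : ℝ → ℝ} (h : IsSpectrumProfile d f)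
    {θ t : ℝ} (hθ0 : 0 < θ) (hθ1 : θ ≤ 1)
    (ht : Admissible (blockSet d (branchCount d f)) θ t) : t ≤ f θ := by
  obtain ⟨C, hC, ht⟩ := ht
  set K : ℝ := d * (1 / θ + 1 + d) with hK
  suffices hs : (t - f θ) / θ ≤ 0 by
    rw [div_le_iff₀ hθ0] at hs
    linarith
  refine nonpos_of_forall_rpow_le (C := C * 2 ^ ((2 * t - f θ) / θ)) (K := 2 ^ K)
    (by positivity) fun k => ?_
  set R : ℝ := (k + 2) / θ with hR
  have hR0 : 0 < R := by positivity
  set n : ℕ := ⌈R⌉₊ + d with hn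
  have hn1 : R + d ≤ n := by rw [hn]; push_cast; linarith [Nat.le_ceil R]
  have hn2 : (n : ℝ) ≤ R + d + 1 := by rw [hn]; push_cast; linarith [Nat.ceil_lt_add_one hR0.le]
  have hmR : ((k : ℝ) + 1) / θ ≤ R := by rw [hR]; gcongr; norm_num
  have hm : (k : ℝ) + 1 ≤ (k + 1) / θ := le_div_self (by positivity) hθ0 hθ1
  have hmn : ((k : ℝ) + 1) / θ ≤ n := by linarith [(d.cast_nonneg : (0 : ℝ) ≤ d)]
  have hkn : k + 1 ≤ n := by
    have : ((k + 1 : ℕ) : ℝ) ≤ n := by push_cast; linarith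
    exact_mod_cast this
  obtain ⟨x, T, hT, hcard⟩ := exists_blockSet_cover hd (branchCount_mono h) (branchCount_step hd h)
    (branchCount_eq_zero h) k n hkn (natCast_mul_half_pow_le hn1)
  have hRθ : ((2 : ℝ) ^ (-R)) ^ θ = (1 / 2) ^ (k + 2) := by
    rw [half_pow_eq_rpow, ← Real.rpow_mul two_pos.le, hR]
    congr 1; push_cast; field_simp
  have h1 := ht (2 ^ (-R)) (by positivity)
    (Real.rpow_lt_one_of_one_lt_of_neg one_lt_two (by linarith)) x T (by rwa [hRθ])
  have h2 : ((branchCount d f k n * d : ℕ) : ℝ) ≤ (k + 1) / θ * f θ + K := by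
    push_cast
    have h3 := branchCount_mul_le hd h hkn
    have h4 := h.scaleGrowth_le_add (by positivity) hm hmn
    rw [IsSpectrumProfile.scaleGrowth_div (by positivity)] at h4
    have h5 : (n : ℝ) - (k + 1) / θ ≤ 1 / θ + 1 + d := by
      have : R = (k + 1) / θ + 1 / θ := by rw [hR]; field_simp; ring
      linarith
    have h6 : (d : ℝ) * (n - (k + 1) / θ) ≤ K := by rw [hK]; gcongr
    linarith
  have h3 : (T.card : ℝ) ≤ 2 ^ ((k + 1) / θ * f θ + K) := by
    calc (T.card : ℝ) ≤ ((2 ^ (branchCount d f k n * d) : ℕ) : ℝ) := by exact_mod_cast hcard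
      _ = 2 ^ ((branchCount d f k n * d : ℕ) : ℝ) := by
        rw [Real.rpow_natCast]; push_cast; rfl
      _ ≤ _ := Real.rpow_le_rpow_of_exponent_le one_le_two h2
  have h4 := h1.trans h3
  rw [← Real.rpow_mul two_pos.le, Real.rpow_add two_pos, ← div_le_iff₀' (by positivity),
    mul_div_assoc, ← Real.rpow_sub two_pos] at h4
  rw [mul_assoc, ← Real.rpow_add two_pos]
  have h5 : (2 * t - f θ) / θ + k * ((t - f θ) / θ) = -R * -t - (k + 1) / θ * f θ := by
    rw [hR]; field_simp; ring
  rwa [h5]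

/-! ### Realization and conclusion -/

theorem blockSet_nonempty (d : ℕ) (c : ℕ → ℕ → ℕ) : (blockSet d c).Nonempty :=
  ⟨0, 0, Or.inl fun i => by simpa using zero_mem_digitSet (c 0)⟩

theorem isSpectrumProfile_of_mem_classH {d : ℝ} {φ : Set.Ioc (0 : ℝ) 1 → Set.Icc (0 : ℝ) d}
    (hφ : φ ∈ classH d) :
    IsSpectrumProfile d fun θ => if h : θ ∈ Set.Ioc (0 : ℝ) 1 then (φ ⟨θ, h⟩ : ℝ) else 0 := by
  have hval : ∀ θ (h0 : 0 < θ) (h1 : θ ≤ 1),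
      (if h : θ ∈ Set.Ioc (0 : ℝ) 1 then (φ ⟨θ, h⟩ : ℝ) else 0) = φ ⟨θ, h0, h1⟩ :=
    fun θ h0 h1 => dif_pos ⟨h0, h1⟩
  have hmul : ∀ l θ : ℝ, 0 < l → l ≤ 1 → 0 < θ → θ ≤ 1 → 0 < l * θ ∧ l * θ ≤ 1 :=
    fun l θ hl0 hl1 h0 h1 => ⟨mul_pos hl0 h0, mul_le_one₀ hl1 h0.le h1⟩
  -- Superadditivity at l = θ = 1 reads φ(1) ≥ 2φ(1); the weak Lipschitz bound at l = 1 then yields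
  -- φ(θ) ≤ (1-θ)d.
  have h11 : (φ ⟨1, one_pos, le_rfl⟩ : ℝ) ≤ 0 := by
    have := hφ.1 ⟨1, one_pos, le_rfl⟩ ⟨1, one_pos, le_rfl⟩
    have h1 : (⟨1, one_pos, le_rfl⟩ : Set.Ioc (0 : ℝ) 1) * ⟨1, one_pos, le_rfl⟩ =
      ⟨1, one_pos, le_rfl⟩ := Subtype.ext (one_mul 1)
    rw [h1] at this
    simp only [one_mul] at this
    linarith
  refine ⟨fun θ h0 h1 => ?_, fun θ h0 h1 => ?_, fun l θ hl0 hl1 h0 h1 => ?_,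
    fun l θ hl0 hl1 h0 h1 => ?_⟩
  · rw [hval θ h0 h1]; exact (φ _).2.1
  · rw [hval θ h0 h1]
    have := hφ.2 ⟨1, one_pos, le_rfl⟩ ⟨θ, h0, h1⟩
    have hm : (⟨1, one_pos, le_rfl⟩ : Set.Ioc (0 : ℝ) 1) * ⟨θ, h0, h1⟩ = ⟨θ, h0, h1⟩ :=
      Subtype.ext (one_mul θ)
    rw [hm] at this
    simp only at this
    nlinarith
  · rw [hval θ h0 h1, hval l hl0 hl1, hval (l * θ) (hmul l θ hl0 hl1 h0 h1).1
      (hmul l θ hl0 hl1 h0 h1).2]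
    exact hφ.1 ⟨l, hl0, hl1⟩ ⟨θ, h0, h1⟩
  · rw [hval l hl0 hl1, hval (l * θ) (hmul l θ hl0 hl1 h0 h1).1 (hmul l θ hl0 hl1 h0 h1).2]
    exact hφ.2 ⟨l, hl0, hl1⟩ ⟨θ, h0, h1⟩

/-- Every function of `classH` is the normalized lower spectrum of a subset of Euclidean space. -/
theorem exists_normalizedLowerSpectrum_eq {d : ℕ}
    {φ : Set.Ioc (0 : ℝ) 1 → Set.Icc (0 : ℝ) (d : ℝ)} (hφ : φ ∈ classH (d : ℝ)) :
    ∃ F : Set (EuclideanSpace ℝ (Fin d)), F.Nonempty ∧ ∀ θ : Set.Ioc (0 : ℝ) 1,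
      normalizedLowerSpectrum F θ = ENNReal.ofReal (φ θ : ℝ) := by
  -- Digit counts divide by d, so d = 0 is separate; there all values lie in [0, 0].
  rcases Nat.eq_zero_or_pos d with rfl | hd
  · obtain ⟨φ', -, h'⟩ := exists_mem_classH_normalizedLowerSpectrum
      (Set.univ_nonempty (α := EuclideanSpace ℝ (Fin 0)))
    have hzero : ∀ x : Set.Icc (0 : ℝ) ((0 : ℕ) : ℝ), (x : ℝ) = 0 := fun x =>
      le_antisymm (by simpa using x.2.2) x.2.1
    exact ⟨Set.univ, Set.univ_nonempty, fun θ => by rw [h', hzero, hzero]⟩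
  have hprof := isSpectrumProfile_of_mem_classH hφ
  set f : ℝ → ℝ := fun θ => if h : θ ∈ Set.Ioc (0 : ℝ) 1 then (φ ⟨θ, h⟩ : ℝ) else 0 with hf
  have hne := blockSet_nonempty d (branchCount d f)
  have := hne.to_subtype
  refine ⟨_, hne, fun θ => ?_⟩
  have hθ : f θ = φ θ := dif_pos θ.2
  have hadm := admissible_blockSet hd hprof θ.2.1 θ.2.2
  rw [normalizedLowerSpectrum_eq_iSup]
  apply le_antisymm
  · refine iSup₂_le fun t ht => ?_
    rw [ENNReal.le_ofReal_iff_toReal_le (by simp) (φ θ).2.1, ← hθ]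
    exact ht.le_of_blockSet hd hprof θ.2.1 θ.2.2
  · refine le_iSup₂_of_le (φ θ : ℝ).toNNReal ?_ le_rfl
    rwa [Real.coe_toNNReal _ (φ θ).2.1, ← hθ]

theorem theoremA (d : ℕ) :
    (∀ φ : Set.Ioc (0 : ℝ) 1 → Set.Icc (0 : ℝ) (d : ℝ),
      (∃ F : Set (EuclideanSpace ℝ (Fin d)), F.Nonempty ∧
        ∀ θ : Set.Ioc (0 : ℝ) 1,
          normalizedLowerSpectrum F θ = ENNReal.ofReal (φ θ : ℝ)) ↔
      ∀ l θ : Set.Ioc (0 : ℝ) 1,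
        (φ θ : ℝ) ≤ (φ (l * θ) : ℝ) - (θ : ℝ) * (φ l : ℝ) ∧
        (φ (l * θ) : ℝ) - (θ : ℝ) * (φ l : ℝ) ≤ (1 - (θ : ℝ)) * (d : ℝ)) ∧
    {ψ : Set.Ioc (0 : ℝ) 1 → ℝ≥0∞ |
      ∃ F : Set (EuclideanSpace ℝ (Fin d)), F.Nonempty ∧ ψ = normalizedLowerSpectrum F} =
    (fun (φ : Set.Ioc (0 : ℝ) 1 → Set.Icc (0 : ℝ) (d : ℝ)) (θ : Set.Ioc (0 : ℝ) 1) =>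
      ENNReal.ofReal (φ θ : ℝ)) '' classH (d : ℝ) := by
  have hclass : ∀ φ : Set.Ioc (0 : ℝ) 1 → Set.Icc (0 : ℝ) (d : ℝ), φ ∈ classH (d : ℝ) ↔
      ∀ l θ : Set.Ioc (0 : ℝ) 1,
        (φ θ : ℝ) ≤ (φ (l * θ) : ℝ) - (θ : ℝ) * (φ l : ℝ) ∧
        (φ (l * θ) : ℝ) - (θ : ℝ) * (φ l : ℝ) ≤ (1 - (θ : ℝ)) * (d : ℝ) := fun φ =>
    ⟨fun h l θ => ⟨le_sub_iff_add_le.2 (h.1 l θ), sub_le_iff_le_add.2 (h.2 l θ)⟩,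
      fun h => ⟨fun l θ => le_sub_iff_add_le.1 (h l θ).1,
        fun l θ => sub_le_iff_le_add.1 (h l θ).2⟩⟩
  refine ⟨fun φ => ?_, ?_⟩
  · rw [← hclass]
    refine ⟨?_, exists_normalizedLowerSpectrum_eq⟩
    rintro ⟨F, hF, h⟩
    obtain ⟨φ', hφ', h'⟩ := exists_mem_classH_normalizedLowerSpectrum hF
    have : φ = φ' := by
      funext θ
      have := (h θ).symm.trans (h' θ)
      exact Subtype.ext ((ENNReal.ofReal_eq_ofReal_iff (φ θ).2.1 (φ' θ).2.1).1 this)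
    rwa [this]
  · ext ψ
    constructor
    · rintro ⟨F, hF, rfl⟩
      obtain ⟨φ, hφ, h⟩ := exists_mem_classH_normalizedLowerSpectrum hF
      exact ⟨φ, hφ, funext fun θ => (h θ).symm⟩
    · rintro ⟨φ, hφ, rfl⟩
      obtain ⟨F, hF, h⟩ := exists_normalizedLowerSpectrum_eq hφ
      exact ⟨F, hF, funext fun θ => (h θ).symm⟩
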